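/- Let $n,p,m$ be nonnegative integers with $n\neq 1$ or $p\le 1$, fix a matrix $D\in\mathbb{R}^{m\times p}$ and $\lambda>0$, and let $(X,y)$ be a random element of $\mathbb{R}^{n\times p}\times\mathbb{R}^n$ whose joint distribution is absolutely continuous with respect to $(np+n)$-dimensional Lebesgue measure. Let $X_1,\dots,X_p$ be the columns of $X$ and $W_X=\mathrm{diag}(\|X_1\|_2,\dots,\|X_p\|_2)\in\mathbb{R}^{p\times p}$ (for $n\ge 1$, $W_X$ is almost surely invertible; for $n=0$ the matrix $XW_X^{-1}$ is read as the empty $0\times p$ matrix). If $p\le n$, or else $p>n$ and $\dim\mathrm{null}(D)\le n$, then almost surely the scaled generalized lasso problem $$\mathop{\mathrm{minimize}}_{\beta\in\mathbb{R}^p}\ \tfrac12\|y-XW_X^{-1}\beta\|_2^2+\lambda\|D\beta\|_1$$ has exactly one solution. -/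

import Mathlib

open MeasureTheory

noncomputable section

namespace GenLasso

/-- The objective `½ ‖y - X β‖₂² + lam ‖D β‖₁` of the generalized lasso with response `y`,
predictor matrix `X`, penalty matrix `D` and tuning parameter `lam`. -/
def objective {n p m : ℕ} (D : Matrix (Fin m) (Fin p) ℝ) (lam : ℝ)
    (X : Matrix (Fin n) (Fin p) ℝ) (y : Fin n → ℝ) (β : Fin p → ℝ) : ℝ :=
  1 / 2 * ‖WithLp.toLp 2 (y - X.mulVec β)‖ ^ 2 + lam * ∑ i, |D.mulVec β i|

/-- `β` is a solution of the generalized lasso problem: a global minimizer of the objective. -/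
def IsSolution {n p m : ℕ} (D : Matrix (Fin m) (Fin p) ℝ) (lam : ℝ)
    (X : Matrix (Fin n) (Fin p) ℝ) (y : Fin n → ℝ) (β : Fin p → ℝ) : Prop :=
  ∀ β' : Fin p → ℝ, objective D lam X y β ≤ objective D lam X y β'

/-- The diagonal matrix `W_X = diag(‖X₁‖₂, …, ‖X_p‖₂)` of Euclidean norms of the columns. -/
def colNorms {n p : ℕ} (X : Matrix (Fin n) (Fin p) ℝ) : Matrix (Fin p) (Fin p) ℝ :=
  Matrix.diagonal fun j => ‖WithLp.toLp 2 (fun i => X i j)‖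

/-- The scaled predictor matrix `X W_X⁻¹`. -/
def scaled {n p : ℕ} (X : Matrix (Fin n) (Fin p) ℝ) : Matrix (Fin n) (Fin p) ℝ :=
  X * (colNorms X)⁻¹

/-- The dimension of the null space of `D`. -/
def nullity {p m : ℕ} (D : Matrix (Fin m) (Fin p) ℝ) : ℕ :=
  Module.finrank ℝ (LinearMap.ker D.mulVecLin)

end GenLasso

end

/-! Two solutions have the same fit and no sign conflicts in `D β`, so their difference lies in `ker
M ∩ L`, where `L = signSpace D s` and `s` is the sign pattern at their midpoint. If `dim L ≤ n`, a
generic `M` is injective on `L` and the solutions agree. If `dim L > n`, a generic `M` has a kernel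
vector in `L` on which `sᵀ D` is nonzero, which contradicts first-order optimality. Existence is
coercivity, from `ker M ∩ ker D = 0`. There are finitely many patterns `s`, and both requirements
reduce to injectivity of the scaled matrix on a fixed subspace of dimension at most `n`
(`ae_injOn`). Only `X` has to be generic; `y` is arbitrary. -/

namespace GenLasso

/-! ### Existence and uniqueness for a fixed matrix in general position -/

section Deterministic

variable {n p m : ℕ} {D : Matrix (Fin m) (Fin p) ℝ} {lam : ℝ} {M : Matrix (Fin n) (Fin p) ℝ}
  {y : Fin n → ℝ}

lemma objective_eq (D : Matrix (Fin m) (Fin p) ℝ) (lam : ℝ) (M : Matrix (Fin n) (Fin p) ℝ)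
    (y : Fin n → ℝ) (β : Fin p → ℝ) :
    objective D lam M y β =
      1 / 2 * ∑ i, (y i - M.mulVec β i) ^ 2 + lam * ∑ i, |D.mulVec β i| := by
  simp [objective, EuclideanSpace.real_norm_sq_eq]

/-- The subspace of vectors `v` such that `D v` vanishes wherever the sign pattern `s` does. -/
def signSpace (D : Matrix (Fin m) (Fin p) ℝ) (s : Fin m → SignType) :
    Submodule ℝ (Fin p → ℝ) where
  carrier := {v | ∀ i, s i = 0 → D.mulVec v i = 0}
  zero_mem' := by simp
  add_mem' ha hb i hi := by simp [Matrix.mulVec_add, ha i hi, hb i hi]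
  smul_mem' c v hv i hi := by simp [Matrix.mulVec_smul, hv i hi]

lemma mem_signSpace {s : Fin m → SignType} {v : Fin p → ℝ} :
    v ∈ signSpace D s ↔ ∀ i, s i = 0 → D.mulVec v i = 0 := Iff.rfl

lemma signSpace_zero : signSpace D 0 = LinearMap.ker D.mulVecLin := by
  ext v
  simp [mem_signSpace, funext_iff]

/-- The linear functional `v ↦ sᵀ D v` attached to a sign pattern `s`. -/
def signFunctional (D : Matrix (Fin m) (Fin p) ℝ) (s : Fin m → SignType) :
    (Fin p → ℝ) →ₗ[ℝ] ℝ where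
  toFun v := ∑ i, (s i : ℝ) * D.mulVec v i
  map_add' u v := by simp [Matrix.mulVec_add, mul_add, Finset.sum_add_distrib]
  map_smul' c v := by
    simp only [Matrix.mulVec_smul, Pi.smul_apply, smul_eq_mul, RingHom.id_apply, Finset.mul_sum]
    exact Finset.sum_congr rfl fun i _ => by ring

lemma signFunctional_apply (s : Fin m → SignType) (v : Fin p → ℝ) :
    signFunctional D s v = ∑ i, (s i : ℝ) * D.mulVec v i := rfl

/-- The predictor matrix `M` is in general position relative to the penalty matrix `D`. -/
structure GeneralPosition (D : Matrix (Fin m) (Fin p) ℝ) (M : Matrix (Fin n) (Fin p) ℝ) :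
    Prop where
  injOn : ∀ s, Module.finrank ℝ (signSpace D s) ≤ n →
    ∀ v ∈ signSpace D s, M.mulVec v = 0 → v = 0
  exists_ne : ∀ s, n < Module.finrank ℝ (signSpace D s) →
    (∃ v ∈ signSpace D s, signFunctional D s v ≠ 0) →
    ∃ v ∈ signSpace D s, M.mulVec v = 0 ∧ signFunctional D s v ≠ 0

lemma continuous_objective (D : Matrix (Fin m) (Fin p) ℝ) (lam : ℝ)
    (M : Matrix (Fin n) (Fin p) ℝ) (y : Fin n → ℝ) : Continuous (objective D lam M y) := by
  have hM : Continuous fun β => M.mulVec β := continuous_const.matrix_mulVec continuous_id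
  have hD : Continuous fun β => D.mulVec β := continuous_const.matrix_mulVec continuous_id
  rw [funext (objective_eq D lam M y)]
  fun_prop

/-- A solution exists as soon as the null spaces of `M` and `D` meet trivially. -/
theorem exists_isSolution (hlam : 0 < lam)
    (h : ∀ v, M.mulVec v = 0 → D.mulVec v = 0 → v = 0) : ∃ β, IsSolution D lam M y β := by
  refine (continuous_objective D lam M y).exists_forall_le ?_
  let Φ : (Fin p → ℝ) →ₗ[ℝ] (Fin n → ℝ) × (Fin m → ℝ) := M.mulVecLin.prod D.mulVecLin
  have hΦ : LinearMap.ker Φ = ⊥ := by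
    rw [LinearMap.ker_eq_bot']
    intro v hv
    obtain ⟨h1, h2⟩ := Prod.mk.inj hv
    exact h v h1 h2
  have hlim : Filter.Tendsto (fun β => ‖Φ β‖) (Filter.cocompact _) Filter.atTop :=
    (tendsto_norm_cocompact_atTop).comp
      (LinearMap.isClosedEmbedding_of_injective hΦ).tendsto_cocompact
  -- Uses `r ≤ r² / 2 + 1 / 2` for the residual and `t = lam⁻¹ * (lam * t)` for the penalty.
  have hbound : ∀ β, ‖Φ β‖ ≤ (1 + lam⁻¹) * objective D lam M y β + (1 / 2 + ‖y‖) := by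
    intro β
    set r := ‖WithLp.toLp 2 (y - M.mulVec β)‖ with hr
    set t := ∑ i, |D.mulVec β i| with ht
    have ht0 : 0 ≤ t := Finset.sum_nonneg fun i _ => abs_nonneg _
    have hobj : objective D lam M y β = 1 / 2 * r ^ 2 + lam * t := rfl
    have h1 : ‖M.mulVec β‖ ≤ r + ‖y‖ := by
      have hsub : ‖y - M.mulVec β‖ ≤ r := by
        rw [pi_norm_le_iff_of_nonneg (norm_nonneg _)]
        exact fun i => PiLp.norm_apply_le (WithLp.toLp 2 (y - M.mulVec β)) i
      have := norm_sub_le y (y - M.mulVec β)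
      rw [sub_sub_cancel] at this
      linarith
    have h2 : ‖D.mulVec β‖ ≤ t := by
      rw [pi_norm_le_iff_of_nonneg ht0]
      exact fun i => Finset.single_le_sum (f := fun i => |D.mulVec β i|)
        (fun i _ => abs_nonneg _) (Finset.mem_univ i)
    have h3 : ‖Φ β‖ ≤ ‖M.mulVec β‖ + ‖D.mulVec β‖ :=
      max_le (le_add_of_nonneg_right (norm_nonneg _)) (le_add_of_nonneg_left (norm_nonneg _))
    have h4 : (1 + lam⁻¹) * objective D lam M y β =
        1 / 2 * r ^ 2 + lam * t + lam⁻¹ * (1 / 2 * r ^ 2) + t := by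
      rw [hobj]
      field_simp
      ring
    have h5 : 0 ≤ lam⁻¹ * (1 / 2 * r ^ 2) := by positivity
    have h6 : 0 ≤ lam * t := by positivity
    nlinarith [sq_nonneg (r - 1)]
  have hlim' := Filter.tendsto_atTop_mono hbound hlim
  have hc : 0 < 1 + lam⁻¹ := by positivity
  have := (Filter.tendsto_atTop_add_const_right _ (-(1 / 2 + ‖y‖)) hlim').const_mul_atTop
    (inv_pos.2 hc)
  refine this.congr fun β => ?_
  field_simp
  ring

/-- Parallelogram identity: the convexity defect is explicit, so at two minimizers both nonnegative
defect sums must vanish. -/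
lemma objective_midpoint (D : Matrix (Fin m) (Fin p) ℝ) (lam : ℝ)
    (M : Matrix (Fin n) (Fin p) ℝ) (y : Fin n → ℝ) (β γ : Fin p → ℝ) :
    objective D lam M y ((1 / 2 : ℝ) • (β + γ)) =
      1 / 2 * objective D lam M y β + 1 / 2 * objective D lam M y γ
      - 1 / 8 * ∑ i, (M.mulVec (β - γ) i) ^ 2
      - lam / 2 * ∑ i, (|D.mulVec β i| + |D.mulVec γ i| - |D.mulVec β i + D.mulVec γ i|) := by
  have h1 : ∑ i, (y i - M.mulVec ((1 / 2 : ℝ) • (β + γ)) i) ^ 2 =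
      1 / 2 * ∑ i, (y i - M.mulVec β i) ^ 2 + 1 / 2 * ∑ i, (y i - M.mulVec γ i) ^ 2
      - 1 / 4 * ∑ i, (M.mulVec (β - γ) i) ^ 2 := by
    simp only [Finset.mul_sum, ← Finset.sum_add_distrib, ← Finset.sum_sub_distrib]
    refine Finset.sum_congr rfl fun i _ => ?_
    simp only [Matrix.mulVec_smul, Matrix.mulVec_add, Matrix.mulVec_sub, Pi.smul_apply,
      Pi.add_apply, Pi.sub_apply, smul_eq_mul]
    ring
  have h2 : ∑ i, |D.mulVec ((1 / 2 : ℝ) • (β + γ)) i| =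
      1 / 2 * ∑ i, |D.mulVec β i + D.mulVec γ i| := by
    rw [Finset.mul_sum]
    refine Finset.sum_congr rfl fun i _ => ?_
    rw [Matrix.mulVec_smul, Matrix.mulVec_add, Pi.smul_apply, Pi.add_apply, smul_eq_mul, abs_mul,
      abs_of_pos one_half_pos]
  rw [objective_eq, objective_eq, objective_eq, h1, h2, Finset.sum_sub_distrib,
    Finset.sum_add_distrib]
  ring

/-- Two solutions have the same fit, and the penalty is additive on them. -/
lemma IsSolution.eq_fit_and_abs_add (hlam : 0 < lam) {β γ : Fin p → ℝ}
    (hβ : IsSolution D lam M y β) (hγ : IsSolution D lam M y γ) :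
    M.mulVec (β - γ) = 0 ∧
      ∀ i, |D.mulVec β i| + |D.mulVec γ i| = |D.mulVec β i + D.mulVec γ i| := by
  have hmid := objective_midpoint D lam M y β γ
  have h1 := hβ ((1 / 2 : ℝ) • (β + γ))
  have h2 := hγ ((1 / 2 : ℝ) • (β + γ))
  have hsq : ∀ i ∈ Finset.univ, 0 ≤ (M.mulVec (β - γ) i) ^ 2 := fun i _ => sq_nonneg _
  have habs : ∀ i ∈ Finset.univ,
      0 ≤ |D.mulVec β i| + |D.mulVec γ i| - |D.mulVec β i + D.mulVec γ i| :=
    fun i _ => sub_nonneg.2 (abs_add_le _ _)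
  have hS := Finset.sum_nonneg hsq
  have hT := Finset.sum_nonneg habs
  have hlT := mul_nonneg hlam.le hT
  have hS0 : ∑ i, (M.mulVec (β - γ) i) ^ 2 = 0 := by linarith
  have hT0 : lam * ∑ i, (|D.mulVec β i| + |D.mulVec γ i| - |D.mulVec β i + D.mulVec γ i|) = 0 := by
    linarith
  rw [mul_eq_zero_iff_left hlam.ne', Finset.sum_eq_zero_iff_of_nonneg habs] at hT0
  rw [Finset.sum_eq_zero_iff_of_nonneg hsq] at hS0
  refine ⟨funext fun i => ?_, fun i => sub_eq_zero.1 (hT0 i (Finset.mem_univ i))⟩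
  exact pow_eq_zero_iff two_ne_zero |>.1 (hS0 i (Finset.mem_univ i))

/-- The first-order condition at a solution `β` along the directions in the null space of `M` that
preserve the zeros of `D β`. -/
lemma IsSolution.signFunctional_eq_zero (hlam : 0 < lam) {β u : Fin p → ℝ}
    (hβ : IsSolution D lam M y β) (hu : u ∈ signSpace D fun i => SignType.sign (D.mulVec β i))
    (hMu : M.mulVec u = 0) :
    signFunctional D (fun i => SignType.sign (D.mulVec β i)) u = 0 := by
  set c := signFunctional D (fun i => SignType.sign (D.mulVec β i)) u with hc
  have hterm : ∀ i, ∀ᶠ t : ℝ in nhds 0, |D.mulVec (β + t • u) i| =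
      |D.mulVec β i| + t * ((SignType.sign (D.mulVec β i) : ℝ) * D.mulVec u i) := by
    intro i
    have hlin : ∀ t : ℝ, D.mulVec (β + t • u) i = D.mulVec β i + t * D.mulVec u i := by
      simp [Matrix.mulVec_add, Matrix.mulVec_smul]
    have hcont : Filter.Tendsto (fun t : ℝ => D.mulVec β i + t * D.mulVec u i) (nhds 0)
        (nhds (D.mulVec β i)) := by
      have : Continuous fun t : ℝ => D.mulVec β i + t * D.mulVec u i := by fun_prop
      simpa using this.tendsto 0
    rcases lt_trichotomy (D.mulVec β i) 0 with h | h | h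
    · filter_upwards [hcont.eventually_lt_const h] with t ht
      rw [hlin, abs_of_neg ht, abs_of_neg h, sign_neg h, SignType.coe_neg_one]
      ring
    · have hz := hu i (by simp [h])
      simp [hlin, h, hz]
    · filter_upwards [hcont.eventually_const_lt h] with t ht
      rw [hlin, abs_of_pos ht, abs_of_pos h, sign_pos h, SignType.coe_one]
      ring
  -- Near `t = 0` no sign changes, so the objective varies by exactly `lam * (t * c)`.
  have hmin : IsLocalMin (fun t : ℝ => t * c) 0 := by
    filter_upwards [Filter.eventually_all.2 hterm] with t ht
    have h1 := hβ (β + t • u)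
    rw [objective_eq, objective_eq, Finset.sum_congr rfl fun i _ => ht i, Finset.sum_add_distrib,
      ← Finset.mul_sum, ← signFunctional_apply, ← hc, Matrix.mulVec_add, Matrix.mulVec_smul, hMu,
      smul_zero, add_zero] at h1
    have h2 : 0 ≤ lam * (t * c) := by linarith
    simpa using nonneg_of_mul_nonneg_right h2 hlam
  exact hmin.hasDerivAt_eq_zero (by simpa using (hasDerivAt_id (0 : ℝ)).mul_const c)

/-- In general position, and when the null space of `D` has dimension at most `n`, the generalized
lasso problem has exactly one solution. -/
theorem GeneralPosition.existsUnique_isSolution (hM : GeneralPosition D M) (hlam : 0 < lam)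
    (hD : nullity D ≤ n) : ∃! β, IsSolution D lam M y β := by
  have h0 : Module.finrank ℝ (signSpace D 0) ≤ n := by rwa [signSpace_zero]
  obtain ⟨β, hβ⟩ := exists_isSolution (D := D) (M := M) (y := y) hlam fun v hMv hDv =>
    hM.injOn 0 h0 v (by rw [signSpace_zero]; exact hDv) hMv
  refine ⟨β, hβ, fun γ hγ => ?_⟩
  obtain ⟨hfit, habs⟩ := hγ.eq_fit_and_abs_add hlam hβ
  set μ : Fin p → ℝ := (1 / 2 : ℝ) • (γ + β) with hμdef
  have hDμ : ∀ i, D.mulVec μ i = 1 / 2 * (D.mulVec γ i + D.mulVec β i) := by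
    intro i
    rw [hμdef, Matrix.mulVec_smul, Matrix.mulVec_add, Pi.smul_apply, Pi.add_apply, smul_eq_mul]
  have hμ : IsSolution D lam M y μ := by
    intro δ
    have h1 := hγ δ
    have h2 := hβ δ
    rw [hμdef, objective_midpoint, hfit]
    simp only [habs]
    simp
    linarith
  set s : Fin m → SignType := fun i => SignType.sign (D.mulVec μ i) with hs
  have hmem : γ - β ∈ signSpace D s := by
    intro i hi
    have h1 : D.mulVec γ i + D.mulVec β i = 0 := by
      have := sign_eq_zero_iff.1 hi
      rw [hDμ] at this
      linarith
    have h2 := habs i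
    rw [h1, abs_zero] at h2
    have h3 : D.mulVec γ i = 0 := abs_eq_zero.1 (by
      linarith [abs_nonneg (D.mulVec γ i), abs_nonneg (D.mulVec β i)])
    have h4 : D.mulVec β i = 0 := abs_eq_zero.1 (by
      linarith [abs_nonneg (D.mulVec γ i), abs_nonneg (D.mulVec β i)])
    simp [Matrix.mulVec_sub, h3, h4]
  rcases le_or_gt (Module.finrank ℝ (signSpace D s)) n with hk | hk
  · exact sub_eq_zero.1 (hM.injOn s hk _ hmem hfit)
  · exfalso
    have hval : signFunctional D s μ = ∑ i, |D.mulVec μ i| := by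
      rw [signFunctional_apply]
      exact Finset.sum_congr rfl fun i _ => sign_mul_self _
    -- The value is the ℓ¹ norm of `D μ`; if it vanished, `signSpace D s` would be `ker D`, of
    -- dimension at most `n`.
    have hne : signFunctional D s μ ≠ 0 := by
      intro hz
      rw [hval, Finset.sum_eq_zero_iff_of_nonneg fun i _ => abs_nonneg _] at hz
      have : s = 0 := funext fun i => by
        simpa [hs, sign_eq_zero_iff] using hz i (Finset.mem_univ i)
      rw [this] at hk
      omega
    obtain ⟨u, hu, hMu, hbu⟩ := hM.exists_ne s hk
      ⟨μ, fun i hi => sign_eq_zero_iff.1 hi, hne⟩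
    exact hbu (hμ.signFunctional_eq_zero hlam hu hMu)

end Deterministic

end GenLasso

namespace GenLasso

/-! ### Normalized vectors and translated subspaces -/

section NullSets

variable {n : ℕ}

/-- A line meets a Euclidean sphere in finitely many points. -/
lemma finite_setOf_norm_add_smul_eq (t e : Fin n → ℝ) (he : e ≠ 0) (r : ℝ) :
    {s : ℝ | ‖WithLp.toLp 2 (t + s • e)‖ = r}.Finite := by
  have hA : ∑ i, e i ^ 2 ≠ 0 := by
    intro h
    rw [Finset.sum_eq_zero_iff_of_nonneg fun i _ => sq_nonneg _] at h
    exact he (funext fun i => pow_eq_zero_iff two_ne_zero |>.1 (h i (Finset.mem_univ i)))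
  let q : Polynomial ℝ := .C (∑ i, e i ^ 2) * .X ^ 2 + .C (2 * ∑ i, t i * e i) * .X +
    .C (∑ i, t i ^ 2 - r ^ 2)
  have hq : q ≠ 0 := by
    intro h
    have := Polynomial.natDegree_quadratic (b := 2 * ∑ i, t i * e i)
      (c := ∑ i, t i ^ 2 - r ^ 2) hA
    change q.natDegree = 2 at this
    simp [h] at this
  refine (Polynomial.finite_setOfPred_isRoot hq).subset fun s hs => ?_
  have h1 : ∑ i, (t i + s * e i) ^ 2 = r ^ 2 := by
    rw [← (hs : _ = r), EuclideanSpace.real_norm_sq_eq]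
    simp
  have h2 : ∑ i, (t i + s * e i) ^ 2 =
      (∑ i, e i ^ 2) * s ^ 2 + 2 * (∑ i, t i * e i) * s + ∑ i, t i ^ 2 := by
    simp only [Finset.mul_sum, Finset.sum_mul, ← Finset.sum_add_distrib]
    exact Finset.sum_congr rfl fun i _ => by ring
  simp only [Set.mem_ofPred_eq, Polynomial.IsRoot.def, q, Polynomial.eval_add, Polynomial.eval_mul,
    Polynomial.eval_C, Polynomial.eval_pow, Polynomial.eval_X]
  linarith

/-- The normalization of almost every vector avoids a translate of a proper subspace. -/
theorem ae_normalize_add_notMem (V : Submodule ℝ (Fin n → ℝ)) (hV : V ≠ ⊤) (w : Fin n → ℝ)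
    (h : 2 ≤ n ∨ w ∈ V) :
    ∀ᵐ t : Fin n → ℝ, ‖WithLp.toLp 2 t‖⁻¹ • t + w ∉ V := by
  obtain ⟨f, hf, hfV⟩ := V.exists_le_ker_of_lt_top hV.lt_top
  have hf' : LinearMap.ker f ≠ ⊤ := fun h => hf (LinearMap.ker_eq_top.1 h)
  have hker : ∀ᵐ t : Fin n → ℝ, f t ≠ 0 :=
    measure_eq_zero_iff_ae_notMem.1 (Measure.addHaar_submodule volume _ hf')
  have key : ∀ᵐ t : Fin n → ℝ, f t ≠ -(f w) * ‖WithLp.toLp 2 t‖ := by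
    by_cases hw : f w = 0
    · simpa [hw] using hker
    -- Along a direction `e ∈ ker f`, which exists since `n ≥ 2`, `f` is constant, so each such line
    -- meets the bad set in finitely many points; Fubini concludes.
    have hn : 2 ≤ n := h.resolve_right fun h => hw (hfV h)
    obtain ⟨e, he, he0⟩ : ∃ e ∈ LinearMap.ker f, e ≠ 0 := by
      apply Submodule.exists_mem_ne_zero_of_ne_bot
      apply LinearMap.ker_ne_bot_of_finrank_lt
      rw [Module.finrank_self, Module.finrank_fin_fun]
      exact hn
    have hcont : Continuous f := f.continuous_of_finiteDimensional
    have hmeas : MeasurableSet {t : Fin n → ℝ | f t ≠ -(f w) * ‖WithLp.toLp 2 t‖} := by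
      apply IsOpen.measurableSet
      apply isOpen_ne_fun hcont
      exact continuous_const.mul (PiLp.continuous_toLp 2 _).norm
    refine ae_mem_of_ae_add_linearMap_mem (LinearMap.toSpanSingleton ℝ (Fin n → ℝ) e)
      volume volume hmeas fun t => ?_
    refine measure_eq_zero_iff_ae_notMem.1 (Set.Finite.measure_zero
      (finite_setOf_norm_add_smul_eq t e he0 (-(f t / f w))) volume) |>.mono fun s hs hs' => hs ?_
    have hfe : f e = 0 := he
    simp only [LinearMap.toSpanSingleton_apply, map_add, map_smul, hfe, smul_zero, add_zero] at hs'
    simp only [Set.mem_ofPred_eq]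
    rw [hs']
    field_simp
  filter_upwards [key, hker] with t ht ht0 hmem
  have h1 : f (‖WithLp.toLp 2 t‖⁻¹ • t + w) = 0 := hfV hmem
  have ht' : ‖WithLp.toLp 2 t‖ ≠ 0 := by
    intro h0
    rw [norm_eq_zero, WithLp.toLp_eq_zero] at h0
    exact ht0 (by simp [h0])
  rw [map_add, map_smul, smul_eq_mul] at h1
  apply ht
  field_simp at h1
  linarith

end NullSets

/-! ### Generic injectivity of the column-normalized matrix -/

section Normalized

variable {n p : ℕ}

/-- The matrix obtained from `X` by dividing every column by its Euclidean norm. -/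
noncomputable def normalized (X : Fin n → Fin p → ℝ) : Matrix (Fin n) (Fin p) ℝ :=
  Matrix.of fun i j => ‖WithLp.toLp 2 (fun i => X i j)‖⁻¹ * X i j

/-- With a zero column, the inverse of `colNorms` is the junk value `0`, whereas `normalized` still
rescales the other columns. -/
lemma scaled_eq_normalized (X : Fin n → Fin p → ℝ) (h : ∀ j, (fun i => X i j) ≠ 0) :
    scaled (Matrix.of X) = normalized X := by
  have hinv : (colNorms (Matrix.of X))⁻¹ =
      Matrix.diagonal fun j => ‖WithLp.toLp 2 (fun i => X i j)‖⁻¹ := by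
    apply Matrix.inv_eq_right_inv
    rw [colNorms, Matrix.diagonal_mul_diagonal, ← Matrix.diagonal_one]
    congr 1
    funext j
    exact mul_inv_cancel₀ (by simpa using h j)
  ext i j
  rw [scaled, hinv, Matrix.mul_diagonal, normalized, Matrix.of_apply, Matrix.of_apply, mul_comm]

/-- The embedding of `ℝ^n` into the matrices as the `j`-th column. -/
def columnMap (n : ℕ) {p : ℕ} (j : Fin p) : (Fin n → ℝ) →ₗ[ℝ] (Fin n → Fin p → ℝ) where
  toFun t i := Pi.single j (t i)
  map_add' s t := by ext; simp [Pi.single_add]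
  map_smul' c t := by ext i k; simp [Pi.single_apply]

lemma normalized_add_columnMap_mulVec (X : Fin n → Fin p → ℝ) (j : Fin p) (t : Fin n → ℝ)
    (v : Fin p → ℝ) :
    (normalized (X + columnMap n j t)).mulVec v =
      v j • (‖WithLp.toLp 2 ((fun i => X i j) + t)‖⁻¹ • ((fun i => X i j) + t)) +
        (normalized X).mulVec (Function.update v j 0) := by
  have hj : (fun i => (X + columnMap n j t) i j) = (fun i => X i j) + t := by
    ext i
    simp [columnMap]
  have hk : ∀ k, k ≠ j → (fun i => (X + columnMap n j t) i k) = fun i => X i k := by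
    intro k hk
    ext i
    simp [columnMap, hk]
  ext i
  simp only [Matrix.mulVec, dotProduct, Pi.add_apply, Pi.smul_apply, smul_eq_mul]
  rw [← Finset.add_sum_erase _ _ (Finset.mem_univ j),
    ← Finset.add_sum_erase (a := j) _ (fun k => normalized X i k * Function.update v j 0 k)
      (Finset.mem_univ j), Function.update_self, mul_zero, zero_add]
  congr 1
  · rw [normalized, Matrix.of_apply, hj, congrFun hj i, Pi.add_apply]
    ring
  · refine Finset.sum_congr rfl fun k hk' => ?_
    have hkj := Finset.ne_of_mem_erase hk'
    rw [normalized, normalized, Matrix.of_apply, Matrix.of_apply, hk k hkj, congrFun (hk k hkj) i,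
      Function.update_of_ne hkj]

/-- Injectivity on `L` means that the images of a basis are linearly independent, an open condition.
-/
lemma measurableSet_injOn (L : Submodule ℝ (Fin p → ℝ)) :
    MeasurableSet {X : Fin n → Fin p → ℝ | ∀ v ∈ L, (normalized X).mulVec v = 0 → v = 0} := by
  let b := Module.finBasis ℝ L
  have hmeas : Measurable fun (X : Fin n → Fin p → ℝ) a =>
      (normalized X).mulVec (b a : Fin p → ℝ) := by
    refine measurable_pi_lambda _ fun a => measurable_pi_lambda _ fun i => ?_
    change Measurable fun X => ∑ j, normalized X i j * (b a : Fin p → ℝ) j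
    refine Finset.measurable_sum _ fun j _ => ?_
    have hcol : Continuous fun X : Fin n → Fin p → ℝ => ‖WithLp.toLp 2 (fun i => X i j)‖ :=
      ((PiLp.continuous_toLp 2 _).comp (by fun_prop)).norm
    have hentry : Continuous fun X : Fin n → Fin p → ℝ => X i j := by fun_prop
    exact (hcol.measurable.inv.mul hentry.measurable).mul_const ((b a : Fin p → ℝ) j)
  have hopen := (isOpen_setOfPred_linearIndependent (𝕜 := ℝ) (E := Fin n → ℝ)
    (ι := Fin (Module.finrank ℝ L))).measurableSet
  convert hmeas hopen using 1
  ext X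
  have hcomp : (fun a => (normalized X).mulVec (b a : Fin p → ℝ)) =
      ((normalized X).mulVecLin.domRestrict L) ∘ b := rfl
  simp only [Set.mem_ofPred_eq, Set.mem_preimage]
  constructor
  · intro h
    change LinearIndependent ℝ _
    rw [hcomp]
    refine b.linearIndependent.map' _ (LinearMap.ker_eq_bot'.2 fun v hv => ?_)
    exact Subtype.ext (h v v.2 hv)
  · intro h v hv h0
    change LinearIndependent ℝ _ at h
    rw [Fintype.linearIndependent_iff] at h
    have hv' := b.sum_repr ⟨v, hv⟩
    have hz := h (b.repr ⟨v, hv⟩) (by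
      have := congrArg ((normalized X).mulVecLin.domRestrict L) hv'
      rw [map_sum] at this
      simpa [h0] using this)
    have : (⟨v, hv⟩ : L) = 0 := by
      rw [← hv']
      exact Finset.sum_eq_zero fun a _ => by rw [hz a, zero_smul]
    exact congrArg Subtype.val this

/-- For almost every `X`, the column-normalized matrix is injective on a given subspace of
dimension at most `n`. -/
theorem ae_injOn (hn : n ≠ 1 ∨ p ≤ 1) (L : Submodule ℝ (Fin p → ℝ))
    (hL : Module.finrank ℝ L ≤ n) :
    ∀ᵐ X : Fin n → Fin p → ℝ, ∀ v ∈ L, (normalized X).mulVec v = 0 → v = 0 := by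
  induction hk : Module.finrank ℝ L using Nat.strong_induction_on generalizing L with
  | _ k ih =>
  by_cases hbot : L = ⊥
  · exact .of_forall fun X v hv _ => by simpa [hbot] using hv
  obtain ⟨u, huL, j, huj⟩ : ∃ u ∈ L, ∃ j, u j = 1 := by
    obtain ⟨u, huL, hu⟩ := L.exists_mem_ne_zero_of_ne_bot hbot
    obtain ⟨j, hj⟩ := Function.ne_iff.1 hu
    exact ⟨(u j)⁻¹ • u, L.smul_mem _ huL, j, inv_mul_cancel₀ hj⟩
  set L₀ : Submodule ℝ (Fin p → ℝ) := L ⊓ LinearMap.ker (LinearMap.proj j) with hL₀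
  have hlt : L₀ < L := by
    refine lt_of_le_of_ne inf_le_left fun h => ?_
    have : u ∈ L₀ := h ▸ huL
    have h0 : u j = 0 := this.2
    simp [huj] at h0
  have hrank := Submodule.finrank_lt_finrank_of_lt hlt
  have hIH := ih _ (hk ▸ hrank) L₀ (hrank.le.trans hL) rfl
  -- The union encodes "injective on `L₀` implies injective on `L`". Since `L = L₀ + ℝ u`, and
  -- column `j` does not act on `L₀`, failure puts the normalized new column in a translate of the
  -- image `V` of `L₀`, which is proper because `dim L₀ < n`.
  have hstep : ∀ᵐ X : Fin n → Fin p → ℝ, X ∈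
      {X | ∀ v ∈ L₀, (normalized X).mulVec v = 0 → v = 0}ᶜ ∪
      {X | ∀ v ∈ L, (normalized X).mulVec v = 0 → v = 0} := by
    refine ae_mem_of_ae_add_linearMap_mem (columnMap n j) volume volume
      ((measurableSet_injOn L₀).compl.union (measurableSet_injOn L)) fun X => ?_
    set V := L₀.map (normalized X).mulVecLin with hVdef
    have hV : V ≠ ⊤ := by
      intro h
      have h1 : Module.finrank ℝ V ≤ Module.finrank ℝ L₀ := Submodule.finrank_map_le _ _
      rw [h, finrank_top, Module.finrank_fin_fun] at h1
      omega
    -- Here `n ≥ 1`. For `n = 1` normalized entries are almost surely `±1`, so columns can cancel;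
    -- `p ≤ 1` removes the translate.
    have hw : 2 ≤ n ∨ (normalized X).mulVec (Function.update u j 0) ∈ V := by
      rcases hn with hn | hp
      · left
        omega
      · right
        have : Subsingleton (Fin p) := Fin.subsingleton_iff_le_one.2 hp
        have : Function.update u j 0 = 0 := by
          ext k
          simp [Subsingleton.elim k j]
        rw [this, Matrix.mulVec_zero]
        exact V.zero_mem
    have hae := (measurePreserving_add_left (volume : Measure (Fin n → ℝ))
      (fun i => X i j)).quasiMeasurePreserving.ae (ae_normalize_add_notMem V hV _ hw)
    filter_upwards [hae] with t ht
    by_cases hinj : ∀ v ∈ L₀, (normalized (X + columnMap n j t)).mulVec v = 0 → v = 0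
    swap
    · exact Or.inl hinj
    refine Or.inr fun v hv hv0 => ?_
    by_cases hvj : v j = 0
    · exact hinj v ⟨hv, hvj⟩ hv0
    exfalso
    apply ht
    have hmem : v - v j • u ∈ L₀ :=
      ⟨L.sub_mem hv (L.smul_mem _ huL), by simp [huj]⟩
    have hsplit : Function.update v j 0 = (v - v j • u) + v j • Function.update u j 0 := by
      ext k
      by_cases hkj : k = j
      · subst hkj
        simp [huj]
      · simp [hkj]
    rw [normalized_add_columnMap_mulVec, hsplit, Matrix.mulVec_add, Matrix.mulVec_smul] at hv0
    have heq : v j • (‖WithLp.toLp 2 ((fun i => X i j) + t)‖⁻¹ • ((fun i => X i j) + t) +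
        (normalized X).mulVec (Function.update u j 0)) =
        -(normalized X).mulVec (v - v j • u) := by
      rw [smul_add, eq_neg_iff_add_eq_zero, ← hv0]
      abel
    refine (V.smul_mem_iff hvj).1 ?_
    rw [heq]
    exact V.neg_mem ⟨_, hmem, rfl⟩
  filter_upwards [hIH, hstep] with X h1 h2
  exact h2.resolve_left fun h => h h1

lemma ae_column_ne_zero (hn : n ≠ 0) :
    ∀ᵐ X : Fin n → Fin p → ℝ, ∀ j, (fun i => X i j) ≠ 0 := by
  refine ae_all_iff.2 fun j => ?_
  let f : (Fin n → Fin p → ℝ) →ₗ[ℝ] ℝ :=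
    LinearMap.proj j ∘ₗ LinearMap.proj ⟨0, Nat.pos_of_ne_zero hn⟩
  have hf : LinearMap.ker f ≠ ⊤ := by
    rw [Ne, LinearMap.ker_eq_top]
    intro h
    simpa [f] using LinearMap.congr_fun h fun _ _ => 1
  refine measure_eq_zero_iff_ae_notMem.1 (Measure.addHaar_submodule volume _ hf) |>.mono
    fun X hX h => hX (congrFun h _)

lemma ae_scaled_eq_normalized :
    ∀ᵐ X : Fin n → Fin p → ℝ, scaled (Matrix.of X) = normalized X := by
  rcases eq_or_ne n 0 with rfl | hn
  · exact .of_forall fun X => Subsingleton.elim _ _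
  · exact (ae_column_ne_zero hn).mono fun X => scaled_eq_normalized X

variable {m : ℕ}

/-- `M` maps `W` onto `ℝ^n`, so `M v` can be cancelled by an element of `W`, which does not affect
`f v`. -/
lemma exists_mulVec_eq_zero_of_injOn {M : Matrix (Fin n) (Fin p) ℝ}
    {W L : Submodule ℝ (Fin p → ℝ)} {f : (Fin p → ℝ) →ₗ[ℝ] ℝ} (hWL : W ≤ L ⊓ LinearMap.ker f)
    (hW : Module.finrank ℝ W = n) (hM : ∀ v ∈ W, M.mulVec v = 0 → v = 0)
    {v : Fin p → ℝ} (hv : v ∈ L) (hfv : f v ≠ 0) :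
    ∃ u ∈ L, M.mulVec u = 0 ∧ f u ≠ 0 := by
  have hinj : Function.Injective (M.mulVecLin.domRestrict W) :=
    LinearMap.ker_eq_bot.1 (LinearMap.ker_eq_bot'.2 fun w hw => Subtype.ext (hM w w.2 hw))
  have hsurj := (LinearMap.injective_iff_surjective_of_finrank_eq_finrank
    (by rw [hW, Module.finrank_fin_fun])).1 hinj
  obtain ⟨w, hw⟩ := hsurj (M.mulVec v)
  have hfw : f w = 0 := (hWL w.2).2
  refine ⟨v - w, L.sub_mem hv (hWL w.2).1, ?_, by simpa [hfw] using hfv⟩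
  rw [Matrix.mulVec_sub, sub_eq_zero]
  exact hw.symm

/-- Intersecting with `ker f` costs at most one dimension. -/
lemma exists_le_inf_ker_finrank_eq {L : Submodule ℝ (Fin p → ℝ)} (hL : n < Module.finrank ℝ L)
    (f : (Fin p → ℝ) →ₗ[ℝ] ℝ) :
    ∃ W ≤ L ⊓ LinearMap.ker f, Module.finrank ℝ W = n := by
  have hn : n ≤ Module.finrank ℝ (L ⊓ LinearMap.ker f : Submodule ℝ (Fin p → ℝ)) := by
    have h1 := Submodule.finrank_sup_add_finrank_inf_eq L (LinearMap.ker f)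
    have h2 := f.finrank_range_add_finrank_ker
    have h3 := Submodule.finrank_le (L ⊔ LinearMap.ker f)
    have h4 := Submodule.finrank_le (LinearMap.range f)
    rw [Module.finrank_self] at h4
    omega
  obtain ⟨b, hb⟩ := exists_linearIndependent_of_le_finrank hn
  refine ⟨Submodule.span ℝ (Set.range fun a => (b a : Fin p → ℝ)), ?_, ?_⟩
  · rw [Submodule.span_le]
    rintro _ ⟨a, rfl⟩
    exact (b a).2
  · have hb' := hb.map' (Submodule.subtype _) (Submodule.ker_subtype _)
    exact (finrank_span_eq_card hb').trans (Fintype.card_fin n)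

/-- Almost every matrix, once scaled, is in general position relative to `D`. -/
theorem ae_generalPosition (D : Matrix (Fin m) (Fin p) ℝ) (hn : n ≠ 1 ∨ p ≤ 1) :
    ∀ᵐ X : Fin n → Fin p → ℝ, GeneralPosition D (scaled (Matrix.of X)) := by
  have h1 : ∀ᵐ X : Fin n → Fin p → ℝ, ∀ s, Module.finrank ℝ (signSpace D s) ≤ n →
      ∀ v ∈ signSpace D s, (normalized X).mulVec v = 0 → v = 0 :=
    ae_all_iff.2 fun s => Filter.eventually_imp_distrib_left.2 fun hs => ae_injOn hn _ hs
  have h2 : ∀ᵐ X : Fin n → Fin p → ℝ, ∀ s, n < Module.finrank ℝ (signSpace D s) →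
      (∃ v ∈ signSpace D s, signFunctional D s v ≠ 0) →
      ∃ v ∈ signSpace D s, (normalized X).mulVec v = 0 ∧ signFunctional D s v ≠ 0 := by
    refine ae_all_iff.2 fun s => Filter.eventually_imp_distrib_left.2 fun hs => ?_
    obtain ⟨W, hWL, hW⟩ := exists_le_inf_ker_finrank_eq hs (signFunctional D s)
    filter_upwards [ae_injOn hn W hW.le] with X hX
    rintro ⟨v, hv, hfv⟩
    exact exists_mulVec_eq_zero_of_injOn hWL hW hX hv hfv
  filter_upwards [h1, h2, ae_scaled_eq_normalized] with X h1 h2 hX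
  rw [hX]
  exact ⟨h1, h2⟩

lemma nullity_le (D : Matrix (Fin m) (Fin p) ℝ) : nullity D ≤ p :=
  (Submodule.finrank_le _).trans_eq (Module.finrank_fin_fun ℝ)

end Normalized

end GenLasso

/-- The joint law of `(X, y)` is a measure on `ℝ^(n × p) × ℝ^n`, whose `volume` is
`(np + n)`-dimensional Lebesgue measure. -/
theorem mainTheorem9 {n p m : ℕ} (D : Matrix (Fin m) (Fin p) ℝ) (lam : ℝ) (hlam : 0 < lam)
    {Ω : Type*} [MeasurableSpace Ω] (P : Measure Ω) [IsProbabilityMeasure P]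
    (X : Ω → Fin n → Fin p → ℝ) (y : Ω → Fin n → ℝ)
    (hmeas : AEMeasurable (fun ω => (X ω, y ω)) P)
    (hac : P.map (fun ω => (X ω, y ω)) ≪
      (volume : Measure ((Fin n → Fin p → ℝ) × (Fin n → ℝ))))
    (hn : n ≠ 1 ∨ p ≤ 1)
    (hdim : p ≤ n ∨ (n < p ∧ GenLasso.nullity D ≤ n)) :
    ∀ᵐ ω ∂P, ∃! β : Fin p → ℝ,
      GenLasso.IsSolution D lam (GenLasso.scaled (Matrix.of (X ω))) (y ω) β := by
  have hD : GenLasso.nullity D ≤ n :=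
    hdim.elim (fun h => (GenLasso.nullity_le D).trans h) And.right
  have hvol : ∀ᵐ z : (Fin n → Fin p → ℝ) × (Fin n → ℝ),
      GenLasso.GeneralPosition D (GenLasso.scaled (Matrix.of z.1)) :=
    Measure.quasiMeasurePreserving_fst.ae (GenLasso.ae_generalPosition D hn)
  filter_upwards [ae_of_ae_map hmeas (hac.ae_le hvol)] with ω hω
  exact hω.existsUnique_isSolution hlam hD
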